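/- Let $R$ be an associative ring with unity, let $\sigma$ be an automorphism of $R$, and let $M$ be a maximal (two-sided) ideal of $R$. A ring is called right quasi-duo if each of its maximal right ideals is two-sided. Let $R[x;\sigma]$ and $R[x,x^{-1};\sigma]$ denote the skew polynomial ring and the skew Laurent polynomial ring, with coefficients written on the left and multiplication determined by $xr=\sigma(r)x$ for $r\in R$. 1. Suppose that $R[x;\sigma]$ is right quasi-duo. Then either $\sigma(M)=M$, or the orbit $\{\sigma^k(M) : k\in\mathbb{Z}\}$ of $M$ under $\sigma$ is infinite. Moreover, if $\sigma(M)=M$, then the ring $R/M$ is a field and the map of $R/M$ induced by $\sigma$ is the identity. 2. Suppose that $R[x,x^{-1};\sigma]$ is right quasi-duo. Then $\sigma(M)=M$, the ring $R/M$ is a field, and the map of $R/M$ induced by $\sigma$ is the identity. -/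

import Mathlib

/-- A ring is right quasi-duo if every maximal right ideal (a maximal proper `Rᵐᵒᵖ`-submodule
of `R`) is also closed under left multiplication, i.e. is two-sided. -/
def IsRightQuasiDuo (R : Type*) [Ring R] : Prop :=
  ∀ I : Submodule Rᵐᵒᵖ R, IsCoatom I → ∀ a : R, ∀ m ∈ I, a * m ∈ I

/-- The action of `ℕ` on `R` by powers of `σ`: `n` acts as `σ ^ n`. -/
abbrev natPowAction {R : Type*} [Ring R] (σ : R ≃+* R) :
    MulSemiringAction (Multiplicative ℕ) R :=
  MulSemiringAction.compHom R (powersHom (R ≃+* R) σ)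

/-- The action of `ℤ` on `R` by powers of `σ`: `n` acts as `σ ^ n`. -/
abbrev intPowAction {R : Type*} [Ring R] (σ : R ≃+* R) :
    MulSemiringAction (Multiplicative ℤ) R :=
  MulSemiringAction.compHom R (zpowersHom (R ≃+* R) σ)

/-- The skew polynomial ring `R[x;σ]`: finite sums `∑ rₙ xⁿ` over `n : ℕ`, coefficients on the
left, multiplied by the rule `x r = σ(r) x`. -/
def SkewPoly {R : Type*} [Ring R] (_σ : R ≃+* R) : Type _ :=
  SkewMonoidAlgebra R (Multiplicative ℕ)

noncomputable instance SkewPoly.instRing {R : Type*} [Ring R] (σ : R ≃+* R) : Ring (SkewPoly σ) :=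
  letI := natPowAction σ
  inferInstanceAs (Ring (SkewMonoidAlgebra R (Multiplicative ℕ)))

/-- The skew Laurent polynomial ring `R[x,x⁻¹;σ]`: finite sums `∑ rₙ xⁿ` over `n : ℤ`,
coefficients on the left, multiplied by the rule `x r = σ(r) x`. -/
def SkewLaurent {R : Type*} [Ring R] (_σ : R ≃+* R) : Type _ :=
  SkewMonoidAlgebra R (Multiplicative ℤ)

noncomputable instance SkewLaurent.instRing {R : Type*} [Ring R] (σ : R ≃+* R) :
    Ring (SkewLaurent σ) :=
  letI := intPowAction σ
  inferInstanceAs (Ring (SkewMonoidAlgebra R (Multiplicative ℤ)))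

/-- The endomorphism `r + M ↦ σ(r) + M` of the ring `R / M`, for a two-sided ideal `M` with
`σ(M) = M`. -/
def inducedMap {R : Type*} [Ring R] (σ : R ≃+* R) (M : TwoSidedIdeal R)
    (h : σ '' (M : Set R) = M) : M.ringCon.Quotient →+* M.ringCon.Quotient :=
  M.ringCon.lift (M.ringCon.mk'.comp (σ : R →+* R)) (by
    intro a b hab
    have hm : a - b ∈ M := (M.rel_iff a b).1 hab
    have hs : σ (a - b) ∈ (M : Set R) := h ▸ Set.mem_image_of_mem σ hm
    rw [map_sub] at hs
    exact (RingCon.eq _).2 ((M.rel_iff _ _).2 hs))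

/-! In a right quasi-duo ring every proper right ideal lies in a proper two-sided ideal. Let `T` be
the skew ring and `f ∈ T`. If an additive map on `T` kills `M * T` and `f * T` but not `1`, then
some two-sided ideal `P` contains `f` and, by maximality of `M`, meets `R` exactly in `M`
(`SkewMonoidAlgebra.exists_twoSidedIdeal`). Identities in `T` modulo `P` then become statements
about `M`: `f = a` gives inverses in `R/M`, `f = x ^ n - 1` controls `σ`, `f = x - a` gives
commutativity, and `f = 0` suffices when `x` is invertible. -/

section QuasiDuo

variable {T : Type*} [Ring T]

theorem IsRightQuasiDuo.exists_twoSidedIdeal (hT : IsRightQuasiDuo T) {A : Type*} [AddCommGroup A]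
    (φ : T →+ A) (s : Set T) (hs : ∀ a ∈ s, ∀ t, φ (a * t) = 0) (h1 : φ 1 ≠ 0) :
    ∃ P : TwoSidedIdeal T, s ⊆ P ∧ (1 : T) ∉ P := by
  have key : ∀ z ∈ Submodule.span Tᵐᵒᵖ s, ∀ t, φ (z * t) = 0 := by
    intro z hz
    induction hz using Submodule.span_induction with
    | mem z hz => exact hs z hz
    | zero => simp
    | add y z _ _ hy hz => intro t; rw [add_mul, map_add, hy, hz, add_zero]
    | smul c z _ hz =>
      intro t
      rw [MulOpposite.smul_eq_mul_unop, mul_assoc]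
      exact hz _
  have hne : Submodule.span Tᵐᵒᵖ s ≠ ⊤ := by
    intro h
    apply h1
    have := key 1 (h ▸ Submodule.mem_top) 1
    rwa [mul_one] at this
  have hTop : (⊤ : Submodule Tᵐᵒᵖ T) = Submodule.span Tᵐᵒᵖ {1} := by
    refine (Submodule.eq_top_iff'.2 fun z ↦ Submodule.mem_span_singleton.2
      ⟨MulOpposite.op z, ?_⟩).symm
    simp
  have : IsCoatomic (Submodule Tᵐᵒᵖ T) := CompleteLattice.coatomic_of_top_compact <| by
    rw [hTop]
    exact Submodule.singleton_span_isCompactElement 1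
  obtain ⟨I, hI, hle⟩ := (eq_top_or_exists_le_coatom (Submodule.span Tᵐᵒᵖ s)).resolve_left hne
  refine ⟨TwoSidedIdeal.mk' I I.zero_mem I.add_mem I.neg_mem (fun {y z} hz ↦ hT I hI y z hz)
    (fun {y z} hy ↦ ?_), fun a ha ↦ ?_, fun h ↦ hI.1 (Submodule.eq_top_iff'.2 fun z ↦ ?_)⟩
  · simpa using I.smul_mem (MulOpposite.op z) hy
  · exact (TwoSidedIdeal.mem_mk' ..).2 (hle (Submodule.subset_span ha))
  · have h' : (1 : T) ∈ I := (TwoSidedIdeal.mem_mk' ..).1 h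
    simpa using I.smul_mem (MulOpposite.op z) h'

end QuasiDuo

/-! ### Maximal two-sided ideals and their quotients -/

section Coatom

variable {R : Type*} [Ring R]

theorem TwoSidedIdeal.mem_of_isCoatom_of_one_notMem {M Q : TwoSidedIdeal R} (hM : IsCoatom M)
    (hle : ∀ m ∈ M, m ∈ Q) (h1 : (1 : R) ∉ Q) {r : R} (hr : r ∈ Q) : r ∈ M := by
  rcases hM.le_iff.1 (show M ≤ Q from hle) with h | h
  · exact absurd (h ▸ trivial) h1
  · exact h ▸ hr

theorem TwoSidedIdeal.one_notMem_of_isCoatom {M : TwoSidedIdeal R} (hM : IsCoatom M) :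
    (1 : R) ∉ M := fun h ↦ hM.1 <| top_le_iff.1 fun r _ ↦ by
  simpa using M.mul_mem_left r 1 h

/-- The preimage of `M` under `σ` is a proper ideal containing `M`, so it equals `M`. -/
theorem TwoSidedIdeal.image_eq_of_isCoatom {M : TwoSidedIdeal R} (hM : IsCoatom M) (σ : R ≃+* R)
    (h : ∀ m ∈ M, σ m ∈ M) : σ '' (M : Set R) = M := by
  have h' : ∀ r, σ r ∈ M → r ∈ M := fun r hr ↦
    mem_of_isCoatom_of_one_notMem (Q := M.comap σ) hM
      (fun m hm ↦ (TwoSidedIdeal.mem_comap _).2 (h m hm))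
      (fun h1 ↦ one_notMem_of_isCoatom hM (by simpa [TwoSidedIdeal.mem_comap] using h1))
      ((TwoSidedIdeal.mem_comap _).2 hr)
  ext r
  refine ⟨?_, fun hr ↦ ⟨σ.symm r, h' _ ?_, σ.apply_symm_apply r⟩⟩
  · rintro ⟨m, hm, rfl⟩
    exact h m hm
  · rwa [σ.apply_symm_apply]

theorem TwoSidedIdeal.isField_quotient {M : TwoSidedIdeal R} (hM : IsCoatom M)
    (hinv : ∀ a, a ∉ M → ∃ b, a * b - 1 ∈ M) (hcomm : ∀ a b, a * b - b * a ∈ M) :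
    IsField M.ringCon.Quotient where
  exists_pair_ne := ⟨1, 0, fun h ↦ one_notMem_of_isCoatom hM <|
    (M.mem_iff 1).2 ((RingCon.eq _).1 h)⟩
  mul_comm := by
    rintro ⟨a⟩ ⟨b⟩
    exact (RingCon.eq _).2 ((M.rel_iff _ _).2 (hcomm a b))
  mul_inv_cancel := by
    rintro ⟨a⟩ ha
    obtain ⟨b, hb⟩ := hinv a fun h ↦ ha ((RingCon.eq _).2 ((M.mem_iff a).1 h))
    exact ⟨(b : M.ringCon.Quotient), (RingCon.eq _).2 ((M.rel_iff _ _).2 hb)⟩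

theorem TwoSidedIdeal.coe_quotient_eq_zero {M : TwoSidedIdeal R} {r : R} :
    (M.ringCon.mk' r) = 0 ↔ r ∈ M :=
  (RingCon.eq _).trans (M.mem_iff r).symm

theorem zpow_mem_iff_of_mem_iff {M : TwoSidedIdeal R} {σ : R ≃+* R}
    (h : ∀ r, σ r ∈ M ↔ r ∈ M) (k : ℤ) (r : R) : (σ ^ k) r ∈ M ↔ r ∈ M := by
  induction k using Int.induction_on generalizing r with
  | zero => simp
  | succ k ih => rw [zpow_add_one, RingAut.mul_apply, ih, h]
  | pred k ih =>
    rw [zpow_sub_one, RingAut.mul_apply, ih, ← h, ← RingAut.mul_apply, mul_inv_cancel,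
      RingAut.one_apply]

end Coatom

/-! ### Choices of `f` and the resulting identities modulo `P` -/

namespace SkewMonoidAlgebra

open Multiplicative

variable {R : Type*} [Ring R] {G : Type*} [CommMonoid G]

/-- The additive map on a graded skew monoid algebra acting as `ψ k` on coefficients of
degree `k`. -/
noncomputable def degreewiseHom {A : Type*} [AddCommGroup A] (d : G →* Multiplicative ℤ)
    (ψ : ℤ → R →+ A) : SkewMonoidAlgebra R G →+ A :=
  (Finsupp.liftAddHom fun g ↦ ψ (toAdd (d g))).comp coeffAddEquiv.toAddMonoidHom

theorem degreewiseHom_single {A : Type*} [AddCommGroup A] (d : G →* Multiplicative ℤ)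
    (ψ : ℤ → R →+ A) (g : G) (r : R) :
    degreewiseHom d ψ (single g r) = ψ (toAdd (d g)) r :=
  Finsupp.liftAddHom_apply_single _ _ _

variable [MulSemiringAction G R] {σ : R ≃+* R} {M : TwoSidedIdeal R}

theorem exists_twoSidedIdeal (hT : IsRightQuasiDuo (SkewMonoidAlgebra R G)) (hM : IsCoatom M)
    {A : Type*} [AddCommGroup A] (d : G →* Multiplicative ℤ) (ψ : ℤ → R →+ A)
    (f : SkewMonoidAlgebra R G) (hψ : ∀ k, ∀ m ∈ M, ψ k m = 0)
    (hf : ∀ g r, degreewiseHom d ψ (f * single g r) = 0) (h1 : ψ 0 1 ≠ 0) :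
    ∃ P : TwoSidedIdeal (SkewMonoidAlgebra R G), f ∈ P ∧ ∀ r, single 1 r ∈ P ↔ r ∈ M := by
  have hsingle : ∀ z : SkewMonoidAlgebra R G, (∀ g r, degreewiseHom d ψ (z * single g r) = 0) →
      ∀ t, degreewiseHom d ψ (z * t) = 0 := by
    intro z hz t
    induction t using SkewMonoidAlgebra.induction_on with
    | zero => simp
    | single g r => exact hz g r
    | add t u ht hu => rw [mul_add, map_add, ht, hu, add_zero]
  obtain ⟨P, hP, hP1⟩ := hT.exists_twoSidedIdeal (degreewiseHom d ψ)
    (insert f (single 1 '' (M : Set R))) (by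
      rintro _ (rfl | ⟨m, hm, rfl⟩)
      · exact hsingle _ hf
      · refine hsingle _ fun g r ↦ ?_
        rw [single_mul_single, one_mul, one_smul, degreewiseHom_single]
        exact hψ _ _ (M.mul_mem_right _ _ hm))
    (by rw [one_def, degreewiseHom_single]; simpa using h1)
  have hle : ∀ m ∈ M, single 1 m ∈ P := fun m hm ↦ hP (Or.inr ⟨m, hm, rfl⟩)
  refine ⟨P, hP (Or.inl rfl), fun r ↦ ⟨fun hr ↦ ?_, hle r⟩⟩
  refine TwoSidedIdeal.mem_of_isCoatom_of_one_notMem (Q := P.comap singleOneRingHom) hM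
    (fun m hm ↦ (TwoSidedIdeal.mem_comap _).2 (hle m hm)) (fun h ↦ hP1 ?_)
    ((TwoSidedIdeal.mem_comap _).2 hr)
  simpa [TwoSidedIdeal.mem_comap] using h

theorem exists_mul_sub_one_mem (hT : IsRightQuasiDuo (SkewMonoidAlgebra R G)) (hM : IsCoatom M)
    (d : G →* Multiplicative ℤ) {a : R} (ha : a ∉ M) : ∃ b, a * b - 1 ∈ M := by
  by_contra! hcon
  let I : AddSubgroup R := M.asIdeal.toAddSubgroup ⊔ (AddMonoidHom.mulLeft a).range
  have hI : (1 : R) ∉ I := by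
    intro h
    obtain ⟨m, hm, _, ⟨b, rfl⟩, h⟩ := AddSubgroup.mem_sup.1 h
    refine hcon b ?_
    have hm : m ∈ M := TwoSidedIdeal.mem_asIdeal.1 hm
    have : a * b - 1 = -m := by rw [← h]; simp
    exact this ▸ M.neg_mem hm
  have hmem : ∀ {r}, r ∈ I → QuotientAddGroup.mk' I r = 0 := fun hr ↦
    (QuotientAddGroup.eq_zero_iff _).2 hr
  -- Here `f = a`, detected by the degree-zero coefficient modulo `aR + M`; then `a ∈ P ∩ R = M`, a
  -- contradiction.
  obtain ⟨P, haP, hP⟩ := exists_twoSidedIdeal hT hM d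
    (fun k ↦ if k = 0 then QuotientAddGroup.mk' I else 0) (single 1 a)
    (fun k m hm ↦ by
      split_ifs
      · exact hmem (AddSubgroup.mem_sup_left (TwoSidedIdeal.mem_asIdeal.2 hm))
      · rfl)
    (fun g r ↦ by
      rw [single_mul_single, one_mul, one_smul, degreewiseHom_single]
      split_ifs
      · exact hmem (AddSubgroup.mem_sup_right ⟨r, rfl⟩)
      · rfl)
    (by
      rw [if_pos rfl]
      exact fun h ↦ hI ((QuotientAddGroup.eq_zero_iff _).1 h))
  exact ha ((hP a).1 haP)

theorem exists_twoSidedIdeal_of_pow (hT : IsRightQuasiDuo (SkewMonoidAlgebra R G))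
    (hM : IsCoatom M) (d : G →* Multiplicative ℤ) (hd : ∀ g (r : R), g • r = (σ ^ toAdd (d g)) r)
    {x : G} (hx : d x = ofAdd 1) {n : ℕ} (hn : ∀ r, (σ ^ n) r ∈ M ↔ r ∈ M) :
    ∃ P : TwoSidedIdeal (SkewMonoidAlgebra R G),
      single (x ^ n) 1 - 1 ∈ P ∧ ∀ r, single 1 r ∈ P ↔ r ∈ M := by
  -- The twist `σ ^ (-k)` cancels the `σ ^ n` produced by moving `x ^ n` past a coefficient.
  let ψ (k : ℤ) : R →+ M.ringCon.Quotient :=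
    if (n : ℤ) ∣ k then
      (M.ringCon.mk' : R →+* M.ringCon.Quotient).toAddMonoidHom.comp
        ((σ ^ (-k) : R ≃+* R) : R →+* R).toAddMonoidHom
    else 0
  have hψ : ∀ (k : ℤ) (r : R), (n : ℤ) ∣ k → ψ k r = M.ringCon.mk' ((σ ^ (-k)) r) := by
    intro k r h
    simp only [ψ, if_pos h]
    rfl
  refine exists_twoSidedIdeal hT hM d ψ _ (fun k m hm ↦ ?_) (fun g r ↦ ?_) ?_
  · by_cases hk : (n : ℤ) ∣ k
    · rw [hψ k m hk, TwoSidedIdeal.coe_quotient_eq_zero]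
      obtain ⟨j, rfl⟩ := hk
      rw [← mul_neg, zpow_mul, zpow_natCast]
      exact (zpow_mem_iff_of_mem_iff hn _ _).2 hm
    · simp only [ψ, if_neg hk, AddMonoidHom.zero_apply]
  · have hdx : toAdd (d (x ^ n)) = (n : ℤ) := by simp [hx]
    rw [sub_mul, one_mul, single_mul_single, one_mul, map_sub, degreewiseHom_single,
      degreewiseHom_single, hd, map_mul, toAdd_mul, hdx]
    by_cases hk : (n : ℤ) ∣ toAdd (d g)
    · rw [hψ _ _ hk, hψ _ _ (dvd_add (dvd_refl _) hk), ← RingAut.mul_apply, ← zpow_add, sub_eq_zero]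
      congr 3
      ring
    · have hk' : ¬ (n : ℤ) ∣ n + toAdd (d g) := by rwa [dvd_add_right (dvd_refl _)]
      simp only [ψ, if_neg hk, if_neg hk', AddMonoidHom.zero_apply, sub_zero]
  · rw [hψ _ _ (dvd_zero _), Ne, TwoSidedIdeal.coe_quotient_eq_zero, map_one]
    exact TwoSidedIdeal.one_notMem_of_isCoatom hM

theorem apply_mem_of_pow (hT : IsRightQuasiDuo (SkewMonoidAlgebra R G))
    (hM : IsCoatom M) (d : G →* Multiplicative ℤ) (hd : ∀ g (r : R), g • r = (σ ^ toAdd (d g)) r)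
    {x : G} (hx : d x = ofAdd 1) {n : ℕ} (hn0 : 0 < n) (hn : ∀ r, (σ ^ n) r ∈ M ↔ r ∈ M) {m : R}
    (hm : m ∈ M) : σ m ∈ M := by
  obtain ⟨P, hxP, hP⟩ := exists_twoSidedIdeal_of_pow hT hM d hd hx hn
  obtain ⟨n, rfl⟩ := Nat.exists_eq_succ_of_ne_zero hn0.ne'
  rw [← hP]
  -- With `n + 1` the original exponent, `x m x ^ n - σ(m) (x ^ (n + 1) - 1) = σ(m)`.
  have h1 : single x 1 * single 1 m * single (x ^ n) 1 ∈ P :=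
    P.mul_mem_right _ _ (P.mul_mem_left _ _ ((hP m).2 hm))
  have h2 : single 1 (σ m) * (single (x ^ (n + 1)) 1 - 1) ∈ P := P.mul_mem_left _ _ hxP
  have h3 := P.sub_mem h1 h2
  rw [mul_sub, single_mul_single, single_mul_single, single_mul_single, hd, hx] at h3
  simpa [pow_succ'] using h3

theorem apply_sub_self_mem (hT : IsRightQuasiDuo (SkewMonoidAlgebra R G))
    (hM : IsCoatom M) (d : G →* Multiplicative ℤ) (hd : ∀ g (r : R), g • r = (σ ^ toAdd (d g)) r)
    {x : G} (hx : d x = ofAdd 1) (hσ : ∀ r, σ r ∈ M ↔ r ∈ M) (r : R) : σ r - r ∈ M := by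
  obtain ⟨P, hxP, hP⟩ := exists_twoSidedIdeal_of_pow (n := 1) hT hM d hd hx (by simpa using hσ)
  rw [← hP]
  -- `(x - 1) r - σ(r) (x - 1) = σ(r) - r`.
  have h := P.sub_mem (P.mul_mem_right _ (single 1 r) hxP)
    (P.mul_mem_left (single 1 (σ r)) _ hxP)
  rw [sub_mul, mul_sub, pow_one, single_mul_single, single_mul_single, hd, hx] at h
  convert h using 1
  simp [sub_eq_add_neg, single_add, single_neg]
  abel

theorem mul_sub_mul_mem (hT : IsRightQuasiDuo (SkewMonoidAlgebra R G))
    (hM : IsCoatom M) (d : G →* Multiplicative ℤ) (hd : ∀ g (r : R), g • r = (σ ^ toAdd (d g)) r)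
    {x : G} (hx : d x = ofAdd 1) (hσ : ∀ r, σ r - r ∈ M) (a b : R) : a * b - b * a ∈ M := by
  by_cases ha : a ∈ M
  · exact M.sub_mem (M.mul_mem_right _ _ ha) (M.mul_mem_left _ _ ha)
  let π : R →+* M.ringCon.Quotient := M.ringCon.mk'
  have hπ : ∀ {r s}, π r = π s ↔ r - s ∈ M := (RingCon.eq _).trans (M.rel_iff _ _)
  have hπ0 : ∀ {r}, π r = 0 ↔ r ∈ M := TwoSidedIdeal.coe_quotient_eq_zero
  have hright : ∀ c, c ∉ M → ∃ e, π c * π e = 1 := fun c hc ↦ by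
    obtain ⟨e, he⟩ := exists_mul_sub_one_mem hT hM d hc
    exact ⟨e, by rw [← map_mul, ← map_one π, hπ]; exact he⟩
  -- A right inverse of `a` modulo `M` has a right inverse too, so `a` is a unit there and `u ^ k`
  -- makes sense for negative `k`.
  obtain ⟨u, hu⟩ : IsUnit (π a) := by
    obtain ⟨c, hc⟩ := hright a ha
    obtain ⟨e, he⟩ := hright c fun h ↦ by
      rw [hπ0.2 h, mul_zero, ← map_zero π, ← map_one π, eq_comm, hπ, sub_zero] at hc
      exact TwoSidedIdeal.one_notMem_of_isCoatom hM hc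
    have hae : π a = π e := left_inv_eq_right_inv hc he
    exact ⟨⟨π a, π c, hc, hae ▸ he⟩, rfl⟩
  let ψ (k : ℤ) : R →+ M.ringCon.Quotient :=
    (AddMonoidHom.mulLeft ((u ^ k : M.ringCon.Quotientˣ) : M.ringCon.Quotient)).comp
      π.toAddMonoidHom
  have hψ : ∀ k r, ψ k r = (u ^ k : M.ringCon.Quotientˣ) * π r := fun _ _ ↦ rfl
  obtain ⟨P, hxP, hP⟩ := exists_twoSidedIdeal hT hM d ψ (single x 1 - single 1 a)
    (fun k m hm ↦ by rw [hψ, hπ0.2 hm, mul_zero])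
    (fun g r ↦ by
      rw [sub_mul, single_mul_single, single_mul_single, one_mul, one_mul, one_smul, map_sub,
        degreewiseHom_single, degreewiseHom_single, hd, map_mul, hx, toAdd_mul, toAdd_ofAdd,
        zpow_one, hψ, hψ, map_mul, ← hu, hπ.2 (hσ r), ← mul_assoc, add_comm, zpow_add_one,
        Units.val_mul, sub_self])
    (by
      rw [hψ, map_one, zpow_zero, Units.val_one, mul_one, Ne, ← map_one π, hπ0]
      exact TwoSidedIdeal.one_notMem_of_isCoatom hM)
  rw [← hP]
  -- `b (x - a) - (x - a) b + (σ(b) - b) x = a b - b a`.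
  have h1 := P.sub_mem (P.mul_mem_left (single 1 b) _ hxP) (P.mul_mem_right _ (single 1 b) hxP)
  have h2 := P.mul_mem_right _ (single x 1) ((hP _).2 (hσ b))
  have h := P.add_mem h1 h2
  rw [sub_mul, mul_sub, single_mul_single, single_mul_single, single_mul_single,
    single_mul_single, single_mul_single, hd x, hx] at h
  convert h using 1
  simp [sub_eq_add_neg, single_add, single_neg]
  abel

theorem apply_mem_of_isUnit (hT : IsRightQuasiDuo (SkewMonoidAlgebra R G))
    (hM : IsCoatom M) (d : G →* Multiplicative ℤ) (hd : ∀ g (r : R), g • r = (σ ^ toAdd (d g)) r)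
    {x y : G} (hx : d x = ofAdd 1) (hxy : x * y = 1) {m : R} (hm : m ∈ M) : σ m ∈ M := by
  let ψ (k : ℤ) : R →+ M.ringCon.Quotient :=
    (M.ringCon.mk' : R →+* M.ringCon.Quotient).toAddMonoidHom
  have hψ : ∀ (k : ℤ) (r : R), ψ k r = M.ringCon.mk' r := fun _ _ ↦ rfl
  obtain ⟨P, -, hP⟩ := exists_twoSidedIdeal hT hM d ψ 0
    (fun k m hm ↦ by rwa [hψ k, TwoSidedIdeal.coe_quotient_eq_zero])
    (fun g r ↦ by rw [zero_mul, map_zero])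
    (by
      rw [hψ 0, Ne, TwoSidedIdeal.coe_quotient_eq_zero]
      exact TwoSidedIdeal.one_notMem_of_isCoatom hM)
  rw [← hP]
  -- Conjugation: `x m x⁻¹ = σ(m)`.
  have h := P.mul_mem_right _ (single y 1) (P.mul_mem_left (single x 1) _ ((hP m).2 hm))
  rw [single_mul_single, single_mul_single, hd, hx] at h
  simpa [hxy] using h

theorem isField_and_inducedMap_eq_id (hT : IsRightQuasiDuo (SkewMonoidAlgebra R G))
    (hM : IsCoatom M) (d : G →* Multiplicative ℤ) (hd : ∀ g (r : R), g • r = (σ ^ toAdd (d g)) r)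
    {x : G} (hx : d x = ofAdd 1) (h : σ '' (M : Set R) = M) :
    IsField M.ringCon.Quotient ∧ inducedMap σ M h = RingHom.id M.ringCon.Quotient := by
  have hσ : ∀ r, σ r ∈ M ↔ r ∈ M := fun r ↦ by
    rw [← SetLike.mem_coe, ← h, σ.injective.mem_set_image, SetLike.mem_coe]
  have hσ' := apply_sub_self_mem hT hM d hd hx hσ
  refine ⟨TwoSidedIdeal.isField_quotient hM (fun a ha ↦ exists_mul_sub_one_mem hT hM d ha)
    (mul_sub_mul_mem hT hM d hd hx hσ'), RingHom.ext ?_⟩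
  rintro ⟨r⟩
  exact (RingCon.eq _).2 ((M.rel_iff _ _).2 (hσ' r))

end SkewMonoidAlgebra

-- Pigeonhole on the translates `σ ^ i • s`.
open scoped Pointwise in
theorem exists_pow_image_eq_of_finite_orbit {R : Type*} [Ring R] {σ : R ≃+* R} {s : Set R}
    (h : (MulAction.orbit (Subgroup.zpowers σ) s).Finite) : ∃ n : ℕ, 0 < n ∧ σ ^ n • s = s := by
  have := h.to_subtype
  obtain ⟨i, j, hij, hne⟩ : ∃ i j : ℕ, σ ^ i • s = σ ^ j • s ∧ i < j := by
    let f (i : ℕ) : MulAction.orbit (Subgroup.zpowers σ) s :=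
      ⟨σ ^ i • s, ⟨⟨σ ^ i, i, zpow_natCast σ i⟩, rfl⟩⟩
    obtain ⟨i, j, hne, hij⟩ := Finite.exists_ne_map_eq_of_infinite f
    have hij' := congrArg Subtype.val hij
    rcases hne.lt_or_gt with hlt | hlt
    · exact ⟨i, j, hij', hlt⟩
    · exact ⟨j, i, hij'.symm, hlt⟩
  refine ⟨j - i, Nat.sub_pos_of_lt hne, ?_⟩
  rw [← smul_left_cancel_iff (σ ^ i), smul_smul, ← pow_add, Nat.add_sub_of_le hne.le, hij]

open scoped Pointwise in
theorem mainTheorem5 {R : Type*} [Ring R] (σ : R ≃+* R)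
    (M : TwoSidedIdeal R) (hM : IsCoatom M) :
    (IsRightQuasiDuo (SkewPoly σ) →
      (σ '' (M : Set R) = M ∨
        (MulAction.orbit (Subgroup.zpowers σ) (M : Set R)).Infinite) ∧
      ∀ h : σ '' (M : Set R) = M,
        IsField M.ringCon.Quotient ∧ inducedMap σ M h = RingHom.id M.ringCon.Quotient) ∧
    (IsRightQuasiDuo (SkewLaurent σ) →
      ∃ h : σ '' (M : Set R) = M,
        IsField M.ringCon.Quotient ∧ inducedMap σ M h = RingHom.id M.ringCon.Quotient) := by
  constructor
  · intro hT
    let _ := natPowAction σ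
    replace hT : IsRightQuasiDuo (SkewMonoidAlgebra R (Multiplicative ℕ)) := hT
    let d : Multiplicative ℕ →* Multiplicative ℤ :=
      AddMonoidHom.toMultiplicative (Nat.castAddMonoidHom ℤ)
    have hd : ∀ (g : Multiplicative ℕ) (r : R), g • r = (σ ^ Multiplicative.toAdd (d g)) r :=
      fun g r ↦ by
        change (σ ^ Multiplicative.toAdd g) r = (σ ^ ((Multiplicative.toAdd g : ℕ) : ℤ)) r
        rw [zpow_natCast]
    have hx : d (Multiplicative.ofAdd 1) = Multiplicative.ofAdd 1 := rfl
    refine ⟨or_iff_not_imp_right.2 fun hfin ↦ ?_,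
      SkewMonoidAlgebra.isField_and_inducedMap_eq_id hT hM d hd hx⟩
    obtain ⟨n, hn0, hn⟩ := exists_pow_image_eq_of_finite_orbit (Set.not_infinite.1 hfin)
    refine TwoSidedIdeal.image_eq_of_isCoatom hM σ fun m hm ↦
      SkewMonoidAlgebra.apply_mem_of_pow hT hM d hd hx hn0 (fun r ↦ ?_) hm
    rw [← SetLike.mem_coe, ← SetLike.mem_coe]
    conv_lhs => rw [← hn]
    exact Set.smul_mem_smul_set_iff (a := σ ^ n)
  · intro hT
    let _ := intPowAction σ
    replace hT : IsRightQuasiDuo (SkewMonoidAlgebra R (Multiplicative ℤ)) := hT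
    have hd : ∀ (g : Multiplicative ℤ) (r : R),
        g • r = (σ ^ Multiplicative.toAdd (MonoidHom.id _ g)) r := fun g r ↦ rfl
    have hx : MonoidHom.id _ (Multiplicative.ofAdd (1 : ℤ)) = Multiplicative.ofAdd 1 := rfl
    have h := TwoSidedIdeal.image_eq_of_isCoatom hM σ fun m hm ↦
      SkewMonoidAlgebra.apply_mem_of_isUnit hT hM _ hd hx (mul_inv_cancel _) hm
    exact ⟨h, SkewMonoidAlgebra.isField_and_inducedMap_eq_id hT hM _ hd hx h⟩
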